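/- Let $\beta\in(0,1)$ and $\rho\in(0,1)$, and let $M=M(N)$ and $k=k(N)\le N$ be sequences of natural numbers such that $M(N)\to\infty$, $M(N)=o(\sqrt N)$ and $k(N)/N\to\rho$ as $N\to\infty$. For every $N$ let the patterns $\xi=(\xi_i^\nu)_{1\le i\le N,\,1\le\nu\le M}$ be independent random variables with $\mathbb P_\xi(\xi_i^\nu=1)=\mathbb P_\xi(\xi_i^\nu=-1)=\tfrac12$. For fixed $\xi$ let $\mu_N$ be the Hopfield Gibbs measure on $\{-1,+1\}^N$ at inverse temperature $\beta$, $$\mu_N(\sigma)=\frac1{Z_N}\exp\Big(\frac{\beta N}{2}\|m_N(\sigma)\|^2\Big),\qquad m_N^\nu(\sigma)=\frac1N\sum_{i=1}^N\sigma_i\xi_i^\nu\quad(1\le\nu\le M),$$ where $\|\cdot\|$ is the Euclidean norm on $\mathbb R^M$ and $Z_N=Z_N(\xi)$ is the normalizing constant. Let $\mu_N^{(k)}$ be the marginal of $\mu_N$ on $(\sigma_1,\dots,\sigma_k)$, and let $\pi$ be the uniform law on $\{-1,+1\}$. Then, in $\mathbb P_\xi$-probability, $$d_{\mathrm{TV}}\big(\mu_N^{(k)},\pi^{\otimes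 k}\big)\longrightarrow 1\qquad(N\to\infty),$$ where $d_{\mathrm{TV}}(\nu,\varrho)=\sup_{A}|\nu(A)-\varrho(A)|$. That is, $\mathbb P_\xi\big(|d_{\mathrm{TV}}(\mu_N^{(k)},\pi^{\otimes k})-1|\ge\varepsilon\big)\to0$ for every $\varepsilon>0$. -/

import Mathlib

open MeasureTheory ProbabilityTheory Filter Topology Asymptotics

noncomputable section

/-- The two-point space `{-1, +1}`: the units of `ℤ` are exactly `1` and `-1`. -/
abbrev Spin : Type := ℤˣ

/-- The real number `1` or `-1` given by a spin. -/
def Spin.toReal (s : Spin) : ℝ := ((s : ℤ) : ℝ)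

/-- The disorder: an `N × M` array of `{-1, +1}`-valued random variables `ξ i ν` on the probability
space `(Ω, P)`, all of them independent, with mean zero (so that each has the law `(δ₁ + δ₋₁) / 2`,
and the second moments are equal to one). Equivalently, the random vectors `ξ i`, `i < N`, are
i.i.d. with independent centred coordinates in `{-1, +1}`. -/
structure IsPatternArray {Ω : Type*} [MeasurableSpace Ω] (P : Measure Ω) {N M : ℕ}
    (ξ : Fin N → Fin M → Ω → Spin) : Prop where
  measurable : ∀ i ν, Measurable (ξ i ν)
  indep : iIndepFun (fun (p : Fin N × Fin M) => ξ p.1 p.2) P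
  mean_zero : ∀ i ν, ∫ ω, (ξ i ν ω).toReal ∂P = 0

/-- The overlap vector `m_N(σ) ∈ ℝ^M`, `m_N^ν(σ) = N⁻¹ ∑ i, σ_i ξ_i^ν`, for fixed patterns `ξ`. -/
def overlap {N M : ℕ} (ξ : Fin N → Fin M → Spin) (σ : Fin N → Spin) :
    EuclideanSpace ℝ (Fin M) :=
  WithLp.toLp 2 fun ν => (1 / (N : ℝ)) * ∑ i, (σ i).toReal * (ξ i ν).toReal

/-- The Boltzmann weight `exp ((β N / 2) ‖m_N(σ)‖²)`, with the Euclidean norm. -/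
def hopfieldWeight (β : ℝ) {N M : ℕ} (ξ : Fin N → Fin M → Spin) (σ : Fin N → Spin) : ℝ :=
  Real.exp (β * N / 2 * ‖overlap ξ σ‖ ^ 2)

/-- The partition function `Z_N`. -/
def hopfieldZ (β : ℝ) {N M : ℕ} (ξ : Fin N → Fin M → Spin) : ℝ :=
  ∑ σ : Fin N → Spin, hopfieldWeight β ξ σ

/-- The Hopfield Gibbs measure `μ_N` on `{-1, +1}^N` at inverse temperature `β`, for fixed
patterns: the measure that gives mass `exp ((β N / 2) ‖m_N(σ)‖²) / Z_N` to `σ`. -/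
def hopfieldGibbs (β : ℝ) {N M : ℕ} (ξ : Fin N → Fin M → Spin) : Measure (Fin N → Spin) :=
  ∑ σ : Fin N → Spin, ENNReal.ofReal (hopfieldWeight β ξ σ / hopfieldZ β ξ) • Measure.dirac σ

/-- The marginal `μ_N^(k)` of `μ_N` on the first `k` spins, for `k ≤ N`. -/
def hopfieldMarginal (β : ℝ) {N M : ℕ} (ξ : Fin N → Fin M → Spin) {k : ℕ} (hk : k ≤ N) :
    Measure (Fin k → Spin) :=
  (hopfieldGibbs β ξ).map fun σ i => σ (Fin.castLE hk i)

/-- The Rademacher law `π` on `{-1, +1}`. -/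
def rademacher : Measure Spin :=
  (2⁻¹ : ENNReal) • Measure.dirac (1 : Spin) + (2⁻¹ : ENNReal) • Measure.dirac (-1 : Spin)

/-- The product law `π^{⊗k}` on `{-1, +1}^k`. -/
def rademacherPi (k : ℕ) : Measure (Fin k → Spin) :=
  Measure.pi fun _ => rademacher

/-- The total variation distance `sup_A |μ(A) - ν(A)|` of two probability measures, the supremum
being over the measurable sets `A`. -/
def tvDist {α : Type*} [MeasurableSpace α] (μ ν : Measure α) : ℝ :=
  ⨆ A : {A : Set α // MeasurableSet A}, |μ.real A - ν.real A|

end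

/-! Under the uniform law the `M` overlaps of the first `k` spins behave like independent centred
Gaussians; under the Gibbs measure they are still nearly Gaussian, but each variance is larger by
the factor `1 / (1 - u)`, `u = βρ / (1 - β + βρ)`. A fixed change of variance in `M → ∞` directions
separates the two laws.

The test statistic `G = partialOverlapExp c` is, up to normalization, the square root of the
heuristic likelihood ratio. For any threshold `t`, `1 - d_TV ≤ μ(G ≤ t) + π(G > t) ≤ t E_μ[1/G] +
E_π[G] / t` (`one_sub_tvDist_hopfieldMarginal_le`). Averaged over the patterns, both errors
factorize into `M` equal factors (`sum_pattern_prod`), each bounded by its Gaussian counterpart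
(`sum_exp_sq_le`). The random normalization `Z_N` is removed by a lower bound valid for every
pattern, with loss `exp (O(M²/N))` (`le_hopfieldZ`). What remains is a constant times the `M`-th
power of a Hellinger affinity below one, and Markov's inequality finishes. -/

lemma Spin.sum_univ {E : Type*} [AddCommMonoid E] (f : Spin → E) :
    ∑ s : Spin, f s = f 1 + f (-1) := by
  simp [UnitsInt.univ]

@[simp] lemma Spin.toReal_one : Spin.toReal 1 = 1 := by simp [Spin.toReal]
@[simp] lemma Spin.toReal_neg_one : Spin.toReal (-1) = -1 := by simp [Spin.toReal]
lemma Spin.toReal_mul (s t : Spin) : Spin.toReal (s * t) = s.toReal * t.toReal := by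
  simp [Spin.toReal]
lemma Spin.toReal_sq (s : Spin) : s.toReal ^ 2 = 1 := by
  rcases Int.units_eq_one_or s with h | h <;> simp [h]
lemma Spin.eq_one_or (s : Spin) : s = 1 ∨ s = -1 := Int.units_eq_one_or s

/-! ### Gaussian domination of quadratic exponential moments of spin sums -/

lemma exp_quadratic_add_le {a : ℝ} (ha0 : 0 ≤ a) (ha : a < 1) (s : ℝ) :
    Real.exp (a * (s + 1) ^ 2 / 2) + Real.exp (a * (s - 1) ^ 2 / 2)
      ≤ 2 * (√(1 - a))⁻¹ * Real.exp (a / (1 - a) * s ^ 2 / 2) := by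
  have h1 : 0 < 1 - a := by linarith
  have e1 : Real.exp (a * (s + 1) ^ 2 / 2) + Real.exp (a * (s - 1) ^ 2 / 2)
      = 2 * Real.exp (a / 2) * Real.exp (a * s ^ 2 / 2) * Real.cosh (a * s) := by
    rw [Real.cosh_eq]
    have : ∀ x y z : ℝ, 2 * x * y * (z / 2) = x * y * z := by intros; ring
    rw [this, mul_add, ← Real.exp_add, ← Real.exp_add, ← Real.exp_add]
    congr 2 <;> ring
  have h2 : Real.exp (a / 2) ≤ (√(1 - a))⁻¹ := by
    rw [← Real.sqrt_inv]
    apply Real.le_sqrt_of_sq_le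
    rw [← Real.exp_nat_mul, le_inv_comm₀ (Real.exp_pos _) h1, ← Real.exp_neg]
    have := Real.add_one_le_exp (-a)
    calc 1 - a ≤ Real.exp (-a) := by linarith
      _ = _ := by congr 1; push_cast; ring
  have h3 : Real.exp (a * s ^ 2 / 2) * Real.cosh (a * s) ≤ Real.exp (a / (1 - a) * s ^ 2 / 2) := by
    calc _ ≤ Real.exp (a * s ^ 2 / 2) * Real.exp ((a * s) ^ 2 / 2) := by
          gcongr; exact Real.cosh_le_exp_half_sq _
      _ = Real.exp ((a + a ^ 2) * s ^ 2 / 2) := by rw [← Real.exp_add]; congr 1; ring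
      -- This is `a + a² ≤ a / (1 - a)`, with defect `a³` after clearing the denominator.
      _ ≤ _ := by
          gcongr
          rw [le_div_iff₀ h1]
          nlinarith [pow_nonneg ha0 3]
  rw [e1, mul_assoc (2 * Real.exp (a / 2))]
  gcongr

/-- The right side is `2 ^ n` times the exact value when the spin sum is replaced by a centred
Gaussian of variance `n`. The Gaussian formulas compose under convolution, so one spin at a time
suffices. -/
lemma sum_exp_sq_le (n : ℕ) {a : ℝ} (ha0 : 0 ≤ a) (ha : a * n < 1) (s : ℝ) :
    ∑ ε : Fin n → Spin, Real.exp (a * (s + ∑ i, (ε i).toReal) ^ 2 / 2)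
      ≤ 2 ^ n * (√(1 - a * n))⁻¹ * Real.exp (a / (1 - a * n) * s ^ 2 / 2) := by
  induction n generalizing s with
  | zero => simp
  | succ n ih =>
    push_cast at ha ⊢
    have hn : 0 < 1 - a * n := by linarith
    have ha1 : a / (1 - a * n) < 1 := by rw [div_lt_one hn]; linarith
    have ha' : 0 < 1 - a / (1 - a * n) := by linarith
    have hn' : 1 - a * (n + 1) ≠ 0 := by linarith
    have hq : 1 - a * (n + 1) = (1 - a * n) * (1 - a / (1 - a * n)) := by field_simp; ring
    have hd : a / (1 - a * n) / (1 - a / (1 - a * n)) = a / (1 - a * (n + 1)) := by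
      rw [hq, div_div]
    -- Split off one spin: the induction hypothesis at `s ± 1` leaves a one-spin sum with
    -- coefficient `a / (1 - a * n)`.
    rw [← (Fin.consEquiv fun _ => Spin).sum_comp, Fintype.sum_prod_type]
    simp only [Fin.consEquiv_apply, Fin.sum_univ_succ, Fin.cons_zero, Fin.cons_succ, ← add_assoc]
    rw [Spin.sum_univ]
    refine (add_le_add (ih (by linarith) _) (ih (by linarith) _)).trans ?_
    rw [← mul_add, Spin.toReal_one, Spin.toReal_neg_one, ← sub_eq_add_neg]
    refine (mul_le_mul_of_nonneg_left
      (exp_quadratic_add_le (div_nonneg ha0 hn.le) ha1 s) (by positivity)).trans_eq ?_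
    rw [hd, hq, Real.sqrt_mul hn.le, mul_inv]
    ring

/-! ### Factorization of sums over spins and patterns -/

/-- A sign change leaves the uniform law on `{-1, +1}^n` invariant. -/
lemma sum_comp_mul_left {n : ℕ} (σ : Fin n → Spin) (f : (Fin n → Spin) → ℝ) :
    ∑ ε : Fin n → Spin, f (σ * ε) = ∑ ε, f ε :=
  Equiv.sum_comp (Equiv.mulLeft σ) f

lemma sum_append {k m : ℕ} (f : (Fin (k + m) → Spin) → ℝ) :
    ∑ ε, f ε = ∑ ε : Fin k → Spin, ∑ δ : Fin m → Spin, f (Fin.append ε δ) := by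
  rw [← (Fin.appendEquiv k m).sum_comp, Fintype.sum_prod_type]
  rfl

/-- For independent columns the sum over all patterns of a product factorizes. -/
lemma sum_pattern_prod {N M : ℕ} (φ : (Fin N → Spin) → ℝ) (σ : Fin N → Spin) :
    ∑ x : Fin N → Fin M → Spin, ∏ ν, φ (fun i => σ i * x i ν) = (∑ ε, φ ε) ^ M := by
  rw [← (Equiv.piComm fun (_ : Fin M) (_ : Fin N) => Spin).sum_comp]
  simp only [Equiv.piComm_apply, Function.swap]
  have := Finset.prod_univ_sum (fun _ : Fin M => (Finset.univ : Finset (Fin N → Spin)))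
    (fun _ ε => φ (σ * ε))
  rw [Fintype.piFinset_univ] at this
  rw [← Fin.prod_const, ← sum_comp_mul_left σ φ, this]
  rfl

lemma sum_exp_spin {n : ℕ} (y : Fin n → ℝ) :
    ∑ σ : Fin n → Spin, Real.exp (∑ i, (σ i).toReal * y i) = 2 ^ n * ∏ i, Real.cosh (y i) := by
  have := Finset.prod_univ_sum (fun _ : Fin n => (Finset.univ : Finset Spin))
    (fun i s => Real.exp (s.toReal * y i))
  rw [Fintype.piFinset_univ] at this
  simp only [Real.exp_sum, ← this, Spin.sum_univ, Real.cosh_eq, Spin.toReal_one,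
    Spin.toReal_neg_one, Finset.prod_div_distrib, Fin.prod_const, one_mul, neg_one_mul]
  field_simp

/-! ### Bounds on the hyperbolic cosine -/

lemma exp_sub_le_cosh (y : ℝ) : Real.exp (y ^ 2 / 2 - y ^ 4 / 8) ≤ Real.cosh y := by
  have h1 : 1 + y ^ 2 / 2 ≤ Real.cosh y := by
    rw [Real.cosh_eq_tsum]
    have hs := (Real.hasSum_cosh y).summable
    have := hs.sum_le_tsum (Finset.range 2) (fun i _ => by
      rw [pow_mul]; positivity)
    simpa [Finset.sum_range_succ] using this
  refine le_trans ?_ h1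
  have hu : 0 ≤ y ^ 2 / 2 := by positivity
  rw [← Real.le_log_iff_exp_le (by positivity)]
  -- With `u = y² / 2`, `log (1 + u) ≥ 2u / (u + 2)`, and `u - u² / 2` lies below this because `u³ ≥
  -- 0`.
  refine le_trans ?_ (Real.le_log_one_add_of_nonneg hu)
  rw [le_div_iff₀ (by positivity)]
  have : 0 ≤ y ^ 6 := by positivity
  nlinarith

lemma pow_four_le_cosh (y : ℝ) : y ^ 4 ≤ 24 * Real.cosh y := by
  have hs := (Real.hasSum_cosh y).summable
  have := hs.sum_le_tsum (Finset.range 3) (fun i _ => by rw [pow_mul]; positivity)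
  rw [← Real.cosh_eq_tsum] at this
  simp [Finset.sum_range_succ, Nat.factorial] at this
  nlinarith [sq_nonneg y]

/-! ### Gaussian integrals -/

open scoped NNReal in
lemma map_sum_mul_pi_gaussianReal {M : ℕ} (v w : ℝ≥0) (a : Fin M → ℝ)
    (hw : (w : ℝ) = v * ∑ ν, a ν ^ 2) :
    (Measure.pi fun _ : Fin M => gaussianReal 0 v).map (fun g => ∑ ν, g ν * a ν)
      = gaussianReal 0 w := by
  have hm : Measurable fun g : Fin M → ℝ => ∑ ν, g ν * a ν := by fun_prop
  have : IsProbabilityMeasure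
      ((Measure.pi fun _ : Fin M => gaussianReal 0 v).map (fun g => ∑ ν, g ν * a ν)) :=
    Measure.isProbabilityMeasure_map hm.aemeasurable
  apply Measure.ext_of_charFun
  ext t
  rw [charFun_apply_real, integral_map hm.aemeasurable (by fun_prop), charFun_gaussianReal]
  have h1 : ∀ g : Fin M → ℝ, Complex.exp (t * ((∑ ν, g ν * a ν : ℝ) : ℂ) * Complex.I)
      = ∏ ν, Complex.exp (((t * a ν : ℝ) : ℂ) * (g ν : ℂ) * Complex.I) := fun g => by
    rw [← Complex.exp_sum]
    congr 1
    push_cast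
    rw [Finset.mul_sum, Finset.sum_mul]
    exact Finset.sum_congr rfl fun ν _ => by ring
  simp_rw [h1]
  rw [integral_fintype_prod_eq_prod
    (f := fun ν (x : ℝ) => Complex.exp (((t * a ν : ℝ) : ℂ) * (x : ℂ) * Complex.I))]
  simp_rw [← charFun_apply_real, charFun_gaussianReal]
  rw [← Complex.exp_sum]
  congr 1
  have : ((w : ℝ) : ℂ) = v * ∑ ν, (a ν : ℂ) ^ 2 := by rw [hw]; push_cast; rfl
  rw [this, Finset.mul_sum, Finset.sum_mul, Finset.sum_div, Complex.ofReal_zero,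
    mul_zero, zero_mul, zero_sub, ← Finset.sum_neg_distrib]
  refine Finset.sum_congr rfl fun ν _ => ?_
  push_cast
  ring

open scoped NNReal in
lemma integrable_pow_gaussianReal (w : ℝ≥0) (n : ℕ) :
    Integrable (fun x : ℝ => x ^ n) (gaussianReal 0 w) :=
  ((memLp_id_gaussianReal' (n : ENNReal) (ENNReal.natCast_ne_top n)).integrable_norm_pow' ).mono'
    (by fun_prop) (by simp)

open scoped NNReal in
lemma integral_sq_gaussianReal (w : ℝ≥0) : ∫ x : ℝ, x ^ 2 ∂gaussianReal 0 w = w := by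
  have := variance_id_gaussianReal (μ := 0) (v := w)
  rwa [variance_eq_integral (by fun_prop), show ∫ x, id x ∂gaussianReal 0 w = 0 from
    integral_id_gaussianReal, show (fun x : ℝ => (id x - 0) ^ 2) = fun x => x ^ 2 by
      ext; simp] at this

open scoped NNReal in
lemma integral_exp_mul_gaussianReal (w : ℝ≥0) (t : ℝ) :
    ∫ x : ℝ, Real.exp (t * x) ∂gaussianReal 0 w = Real.exp (w * t ^ 2 / 2) := by
  have := congrFun (mgf_id_gaussianReal (μ := 0) (v := w)) t
  simpa [mgf] using this

open scoped NNReal in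
lemma integral_pow_four_gaussianReal_le (w : ℝ≥0) :
    ∫ x : ℝ, x ^ 4 ∂gaussianReal 0 w ≤ 48 * (w : ℝ) ^ 2 := by
  rcases eq_or_ne w 0 with rfl | hw
  · simp [gaussianReal_zero_var]
  have hw' : (0 : ℝ) < w := by positivity
  have hs : (√(w : ℝ)) ^ 2 = w := Real.sq_sqrt hw'.le
  have hs0 : 0 < √(w : ℝ) := Real.sqrt_pos.2 hw'
  -- Scaling to unit variance: `w * r ^ 2 = 1`. The resulting constant `24 * exp (1 / 2)` is rounded
  -- up to `48`.
  set r : ℝ := (√(w : ℝ))⁻¹ with hr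
  have hint : ∀ t : ℝ, Integrable (fun x : ℝ => Real.exp (t * x)) (gaussianReal 0 w) :=
    fun t => integrable_exp_mul_gaussianReal t
  calc ∫ x : ℝ, x ^ 4 ∂gaussianReal 0 w
      ≤ ∫ x : ℝ, 12 * (w : ℝ) ^ 2 * (Real.exp (r * x) + Real.exp (-r * x)) ∂gaussianReal 0 w := by
        refine integral_mono (integrable_pow_gaussianReal w 4)
          (((hint r).add (hint (-r))).const_mul _) fun x => ?_
        have := pow_four_le_cosh (r * x)
        rw [Real.cosh_eq] at this
        have e : x ^ 4 = (w : ℝ) ^ 2 * (r * x) ^ 4 := by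
          rw [← hs, hr]; field_simp
        simp only
        rw [e, neg_mul]
        nlinarith [sq_nonneg (w : ℝ), mul_le_mul_of_nonneg_left this (sq_nonneg (w : ℝ))]
    _ = 24 * (w : ℝ) ^ 2 * Real.exp (1 / 2) := by
        rw [integral_const_mul, integral_add (hint r) (hint (-r)),
          integral_exp_mul_gaussianReal, integral_exp_mul_gaussianReal, neg_sq]
        have : (w : ℝ) * r ^ 2 / 2 = 1 / 2 := by
          rw [hr, inv_pow, hs, mul_inv_cancel₀ hw'.ne']
        rw [this]; ring
    _ ≤ _ := by
        have h : Real.exp (1 / 2) ≤ 2 := by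
          have h1 := Real.exp_one_lt_d9
          have h2 : Real.exp (1 / 2) * Real.exp (1 / 2) = Real.exp 1 := by
            rw [← Real.exp_add]; norm_num
          nlinarith [Real.exp_pos (1 / 2)]
        nlinarith [sq_nonneg (w : ℝ)]

open scoped NNReal in
/-- The Gaussian linearization of `exp (s ^ 2 / 2)` with respect to a tilted Gaussian. -/
lemma integral_exp_linear_sub_gaussianReal {β : ℝ} (hβ : β ∈ Set.Ioo (0 : ℝ) 1) (v : ℝ≥0)
    (hv : (v : ℝ) = (1 - β)⁻¹) (s : ℝ) :
    ∫ x : ℝ, Real.exp (x * s - β * x ^ 2 / 2) ∂gaussianReal 0 v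
      = √(1 - β) * Real.exp (s ^ 2 / 2) := by
  have h1 : 0 < 1 - β := by linarith [hβ.2]
  have hv0 : v ≠ 0 := by
    rintro rfl
    exact (inv_pos.2 h1).ne (by simpa using hv)
  rw [integral_gaussianReal_eq_integral_smul hv0]
  -- The factor `exp (-β x² / 2)` turns the density of variance `1 / (1 - β)` into `√(1 - β)` times
  -- the standard one.
  have hd : ∀ x : ℝ, gaussianPDFReal 0 v x • Real.exp (x * s - β * x ^ 2 / 2)
      = √(1 - β) * (gaussianPDFReal 0 1 x • Real.exp (s * x)) := fun x => by
    simp only [gaussianPDFReal, hv, smul_eq_mul, sub_zero, NNReal.coe_one, mul_one]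
    rw [Real.sqrt_mul (by positivity), Real.sqrt_inv, mul_inv, inv_inv]
    have : Real.exp (-x ^ 2 / (2 * (1 - β)⁻¹)) * Real.exp (x * s - β * x ^ 2 / 2)
        = Real.exp (-x ^ 2 / 2) * Real.exp (s * x) := by
      rw [← Real.exp_add, ← Real.exp_add]
      congr 1
      field_simp
      ring
    rw [mul_assoc, this]
    ring
  simp_rw [hd]
  rw [integral_const_mul, ← integral_gaussianReal_eq_integral_smul one_ne_zero,
    integral_exp_mul_gaussianReal]
  simp

lemma exp_integral_le {α : Type*} [MeasurableSpace α] {μ : Measure α} [IsProbabilityMeasure μ]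
    {H : α → ℝ} (hH : Integrable H μ) (he : Integrable (fun x => Real.exp (H x)) μ) :
    Real.exp (∫ x, H x ∂μ) ≤ ∫ x, Real.exp (H x) ∂μ :=
  convexOn_exp.map_integral_le Real.continuous_exp.continuousOn isClosed_univ (by simp) hH he

/-! ### Lower bound on the partition function: linearize, sum over spins, apply Jensen -/

lemma hopfieldWeight_eq_prod (β : ℝ) {N M : ℕ} (hN : 0 < N)
    (ξ : Fin N → Fin M → Spin) (σ : Fin N → Spin) :
    hopfieldWeight β ξ σ
      = ∏ ν, Real.exp (β / N * (∑ i, (σ i * ξ i ν).toReal) ^ 2 / 2) := by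
  have hN' : (0 : ℝ) < N := by exact_mod_cast hN
  rw [hopfieldWeight, ← Real.exp_sum, EuclideanSpace.real_norm_sq_eq, Finset.mul_sum]
  congr 1
  refine Finset.sum_congr rfl fun ν _ => ?_
  simp only [overlap, Spin.toReal_mul]
  field_simp

open scoped NNReal in
lemma integrable_prod_exp_linear_sub_gaussianReal {β : ℝ} (hβ : 0 ≤ β) (v : ℝ≥0) {M : ℕ}
    (s : Fin M → ℝ) :
    Integrable (fun g : Fin M → ℝ => ∏ ν, Real.exp (g ν * s ν - β * g ν ^ 2 / 2))
      (Measure.pi fun _ => gaussianReal 0 v) := by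
  refine Integrable.fintype_prod
    (f := fun ν (x : ℝ) => Real.exp (x * s ν - β * x ^ 2 / 2)) fun ν => ?_
  refine (integrable_exp_mul_gaussianReal (μ := 0) (v := v) (s ν)).mono' (by fun_prop) ?_
  refine Filter.Eventually.of_forall fun x => ?_
  rw [Real.norm_of_nonneg (Real.exp_pos _).le]
  gcongr
  nlinarith [mul_nonneg hβ (sq_nonneg x)]

/-- A lower bound on the partition function that is valid for all patterns. -/
lemma le_hopfieldZ {β : ℝ} (hβ : β ∈ Set.Ioo (0 : ℝ) 1) {N M : ℕ} (hN : 0 < N)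
    (ξ : Fin N → Fin M → Spin) :
    2 ^ N * ((√(1 - β))⁻¹ ^ M * Real.exp (-(6 * (β / (1 - β)) ^ 2 * (M ^ 2 / N))))
      ≤ hopfieldZ β ξ := by
  have hN' : (0 : ℝ) < N := by exact_mod_cast hN
  have h1 : 0 < 1 - β := by linarith [hβ.2]
  have hsq : 0 < √(1 - β) := Real.sqrt_pos.2 h1
  obtain ⟨v, hv⟩ : ∃ v : NNReal, (v : ℝ) = (1 - β)⁻¹ := ⟨⟨(1 - β)⁻¹, by positivity⟩, rfl⟩
  set c : ℝ := √(β / N) with hc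
  have hc2 : c ^ 2 = β / N := Real.sq_sqrt (div_nonneg hβ.1.le hN'.le)
  -- The variance `v c² M` of each `y i`. It does not depend on the patterns since their entries
  -- square to one, which makes the bound deterministic.
  obtain ⟨w, hw⟩ : ∃ w : NNReal, (w : ℝ) = β * M / (N * (1 - β)) :=
    ⟨⟨β * M / (N * (1 - β)), by have := hβ.1; positivity⟩, rfl⟩
  set γ : Measure (Fin M → ℝ) := Measure.pi fun _ => gaussianReal 0 v with hγ
  set y : Fin N → (Fin M → ℝ) → ℝ := fun i g => ∑ ν, g ν * (c * (ξ i ν).toReal) with hy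
  have hym : ∀ i, Measurable (y i) := fun i => by simp only [hy]; fun_prop
  have hlaw : ∀ i, γ.map (y i) = gaussianReal 0 w := fun i => by
    refine map_sum_mul_pi_gaussianReal v w _ ?_
    simp only [mul_pow, Spin.toReal_sq, hc2, hw, hv, Finset.sum_const, Finset.card_univ,
      Fintype.card_fin, nsmul_eq_mul]
    field_simp
  have hyint : ∀ i n, Integrable (fun g => y i g ^ n) γ := fun i n => by
    have := integrable_pow_gaussianReal w n
    rw [← hlaw i] at this
    exact this.comp_measurable (hym i)
  have hy2 : ∀ i, ∫ g, y i g ^ 2 ∂γ = w := fun i => by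
    rw [← integral_sq_gaussianReal w, ← hlaw i,
      integral_map (hym i).aemeasurable (by fun_prop)]
  have hy4 : ∀ i, ∫ g, y i g ^ 4 ∂γ ≤ 48 * (w : ℝ) ^ 2 := fun i => by
    rw [← integral_map (f := fun x : ℝ => x ^ 4) (hym i).aemeasurable (by fun_prop), hlaw i]
    exact integral_pow_four_gaussianReal_le w
  have hgint : ∀ ν, Integrable (fun g : Fin M → ℝ => g ν ^ 2) γ := fun ν =>
    integrable_comp_eval (μ := fun _ : Fin M => gaussianReal 0 v) (i := ν)
      (integrable_pow_gaussianReal v 2)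
  have hg2 : ∀ ν, ∫ g : Fin M → ℝ, g ν ^ 2 ∂γ = v := fun ν => by
    rw [← integral_sq_gaussianReal v]
    exact integral_comp_eval (μ := fun _ : Fin M => gaussianReal 0 v) (i := ν)
      (f := fun x : ℝ => x ^ 2) (by fun_prop)
  set s : (Fin N → Spin) → Fin M → ℝ := fun σ ν => ∑ i, (σ i).toReal * (c * (ξ i ν).toReal)
    with hs
  have hweight : ∀ σ, √(1 - β) ^ M * hopfieldWeight β ξ σ
      = ∫ g, ∏ ν, Real.exp (g ν * s σ ν - β * g ν ^ 2 / 2) ∂γ := fun σ => by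
    rw [hγ, integral_fintype_prod_eq_prod
      (f := fun ν (x : ℝ) => Real.exp (x * s σ ν - β * x ^ 2 / 2))]
    simp_rw [integral_exp_linear_sub_gaussianReal hβ v hv]
    rw [Finset.prod_mul_distrib, Fin.prod_const, hopfieldWeight_eq_prod β hN]
    congr 1
    refine Finset.prod_congr rfl fun ν _ => ?_
    have : s σ ν = c * ∑ i, (σ i * ξ i ν).toReal := by
      rw [hs, Finset.mul_sum]
      exact Finset.sum_congr rfl fun i _ => by rw [Spin.toReal_mul]; ring
    rw [this, mul_pow, hc2]
  -- Averaging the linearized weight over the spins gives `∏ cosh (y i)` times a Gaussian factor;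
  -- `exp H` is a lower bound for it by `exp_sub_le_cosh`.
  set H : (Fin M → ℝ) → ℝ := fun g =>
    ∑ i, (y i g ^ 2 / 2 - y i g ^ 4 / 8) - ∑ ν, β * g ν ^ 2 / 2 with hH
  have hyI : ∀ i ∈ Finset.univ, Integrable (fun g => y i g ^ 2 / 2 - y i g ^ 4 / 8) γ :=
    fun i _ => ((hyint i 2).div_const 2).sub ((hyint i 4).div_const 8)
  have hgI : ∀ ν ∈ Finset.univ, Integrable (fun g : Fin M → ℝ => β * g ν ^ 2 / 2) γ :=
    fun ν _ => ((hgint ν).const_mul β).div_const 2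
  have hHint : Integrable H γ := (integrable_finsetSum _ hyI).sub (integrable_finsetSum _ hgI)
  -- The variance `1 / (1 - β)` makes the quadratic terms cancel, `N w = M β v`. Only the quartic
  -- term `N * 48 w² / 8` is left.
  have hHge : -(6 * (β / (1 - β)) ^ 2 * (M ^ 2 / N)) ≤ ∫ g, H g ∂γ := by
    have : ∫ g, H g ∂γ = ∑ i : Fin N, (w / 2 - (∫ g, y i g ^ 4 ∂γ) / 8)
        - ∑ ν : Fin M, β * v / 2 := by
      rw [integral_sub (integrable_finsetSum _ hyI) (integrable_finsetSum _ hgI),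
        integral_finsetSum _ hyI, integral_finsetSum _ hgI]
      congr 1
      · refine Finset.sum_congr rfl fun i _ => ?_
        rw [integral_sub ((hyint i 2).div_const 2) ((hyint i 4).div_const 8),
          integral_div, integral_div, hy2]
      · refine Finset.sum_congr rfl fun ν _ => ?_
        rw [integral_div, integral_const_mul, hg2]
    rw [this]
    have h4 : ∑ i : Fin N, ((w : ℝ) / 2 - 48 * (w : ℝ) ^ 2 / 8)
        ≤ ∑ i : Fin N, (w / 2 - (∫ g, y i g ^ 4 ∂γ) / 8) := by
      refine Finset.sum_le_sum fun i _ => ?_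
      linarith [hy4 i]
    refine le_trans (le_of_eq ?_) (sub_le_sub_right h4 _)
    simp only [Finset.sum_const, Finset.card_univ, Fintype.card_fin, nsmul_eq_mul, hw, hv]
    field_simp
    ring
  have hsum : ∀ g : Fin M → ℝ, 2 ^ N * Real.exp (H g)
      ≤ ∑ σ, ∏ ν, Real.exp (g ν * s σ ν - β * g ν ^ 2 / 2) := fun g => by
    have e : ∀ σ, ∏ ν, Real.exp (g ν * s σ ν - β * g ν ^ 2 / 2)
        = Real.exp (∑ i, (σ i).toReal * y i g) * Real.exp (-∑ ν, β * g ν ^ 2 / 2) := fun σ => by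
      rw [← Real.exp_sum, ← Real.exp_add, Finset.sum_sub_distrib, sub_eq_add_neg]
      congr 2
      simp only [hs, hy, Finset.mul_sum]
      rw [Finset.sum_comm]
      exact Finset.sum_congr rfl fun i _ => Finset.sum_congr rfl fun ν _ => by ring
    simp_rw [e]
    rw [← Finset.sum_mul, sum_exp_spin, hH]
    simp only
    rw [sub_eq_add_neg, Real.exp_add, ← mul_assoc, Real.exp_sum]
    gcongr
    exact exp_sub_le_cosh _
  have hint : ∀ σ, Integrable
      (fun g => ∏ ν, Real.exp (g ν * s σ ν - β * g ν ^ 2 / 2)) γ := fun σ =>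
    integrable_prod_exp_linear_sub_gaussianReal hβ.1.le v (s σ)
  have hHm : AEStronglyMeasurable H γ := hHint.aestronglyMeasurable
  -- Integrability comes from domination by the finite sum in `hsum`, as `2 ^ N ≥ 1`.
  have hexp : Integrable (fun g => Real.exp (H g)) γ := by
    refine (integrable_finsetSum Finset.univ fun σ _ => hint σ).mono'
      (Real.continuous_exp.comp_aestronglyMeasurable hHm) (Filter.Eventually.of_forall fun g => ?_)
    rw [Real.norm_of_nonneg (Real.exp_pos _).le]
    refine le_trans ?_ (hsum g)
    exact le_mul_of_one_le_left (Real.exp_pos _).le (one_le_pow₀ one_le_two)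
  have key : 2 ^ N * Real.exp (-(6 * (β / (1 - β)) ^ 2 * (M ^ 2 / N)))
      ≤ √(1 - β) ^ M * hopfieldZ β ξ := by
    calc _ ≤ 2 ^ N * Real.exp (∫ g, H g ∂γ) := by gcongr
      _ ≤ 2 ^ N * ∫ g, Real.exp (H g) ∂γ := by
          gcongr; exact exp_integral_le hHint hexp
      _ = ∫ g, 2 ^ N * Real.exp (H g) ∂γ := (integral_const_mul _ _).symm
      _ ≤ ∫ g, ∑ σ, ∏ ν, Real.exp (g ν * s σ ν - β * g ν ^ 2 / 2) ∂γ :=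
          integral_mono (hexp.const_mul _) (integrable_finsetSum _ fun σ _ => hint σ) hsum
      _ = _ := by
          rw [integral_finsetSum _ fun σ _ => hint σ, hopfieldZ, Finset.mul_sum]
          exact Finset.sum_congr rfl fun σ _ => (hweight σ).symm
  calc _ = (√(1 - β))⁻¹ ^ M * (2 ^ N * Real.exp (-(6 * (β / (1 - β)) ^ 2 * (M ^ 2 / N)))) := by ring
    _ ≤ (√(1 - β))⁻¹ ^ M * (√(1 - β) ^ M * hopfieldZ β ξ) := by gcongr
    _ = _ := by rw [← mul_assoc, ← mul_pow, inv_mul_cancel₀ hsq.ne', one_pow, one_mul]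

/-! ### Total variation distance and threshold tests -/

instance Spin.measurableSingletonClass : MeasurableSingletonClass Spin where
  measurableSet_singleton s := by
    refine ⟨{(s : ℤ)}, MeasurableSet.of_discrete, ?_⟩
    ext t
    simp [Units.val_inj]

lemma abs_measureReal_sub_le_one {α : Type*} [MeasurableSpace α] (μ ν : Measure α)
    [IsProbabilityMeasure μ] [IsProbabilityMeasure ν] :
    ∀ A : {A : Set α // MeasurableSet A}, |μ.real A - ν.real A| ≤ 1 := fun A => by
  have h1 : μ.real A ≤ 1 := measureReal_le_one
  have h2 : ν.real A ≤ 1 := measureReal_le_one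
  have h3 : 0 ≤ μ.real A := measureReal_nonneg
  have h4 : 0 ≤ ν.real A := measureReal_nonneg
  rw [abs_le]
  constructor <;> linarith

lemma tvDist_le_one {α : Type*} [MeasurableSpace α] (μ ν : Measure α)
    [IsProbabilityMeasure μ] [IsProbabilityMeasure ν] : tvDist μ ν ≤ 1 :=
  Real.iSup_le (abs_measureReal_sub_le_one μ ν) zero_le_one

lemma one_sub_tvDist_le {α : Type*} [MeasurableSpace α] (μ ν : Measure α)
    [IsProbabilityMeasure μ] [IsProbabilityMeasure ν] {A : Set α} (hA : MeasurableSet A) :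
    1 - tvDist μ ν ≤ μ.real Aᶜ + ν.real A := by
  have h : |μ.real A - ν.real A| ≤ tvDist μ ν :=
    le_ciSup (f := fun A : {A : Set α // MeasurableSet A} => |μ.real A - ν.real A|)
      ⟨1, by rintro _ ⟨B, rfl⟩; exact abs_measureReal_sub_le_one μ ν B⟩ ⟨A, hA⟩
  have := le_abs_self (μ.real A - ν.real A)
  rw [probReal_compl_eq_one_sub hA]
  linarith

lemma hopfieldWeight_pos (β : ℝ) {N M : ℕ} (ξ : Fin N → Fin M → Spin) (σ : Fin N → Spin) :
    0 < hopfieldWeight β ξ σ := Real.exp_pos _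

lemma hopfieldZ_pos (β : ℝ) {N M : ℕ} (ξ : Fin N → Fin M → Spin) : 0 < hopfieldZ β ξ :=
  Finset.sum_pos (fun σ _ => hopfieldWeight_pos β ξ σ) Finset.univ_nonempty

instance isProbabilityMeasure_hopfieldGibbs (β : ℝ) {N M : ℕ} (ξ : Fin N → Fin M → Spin) :
    IsProbabilityMeasure (hopfieldGibbs β ξ) where
  measure_univ := by
    have hZ := hopfieldZ_pos β ξ
    simp only [hopfieldGibbs, Measure.coe_finsetSum, Finset.sum_apply, Measure.smul_apply,
      measure_univ, smul_eq_mul, mul_one]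
    rw [← ENNReal.ofReal_sum_of_nonneg fun σ _ =>
      div_nonneg (hopfieldWeight_pos β ξ σ).le hZ.le, ← Finset.sum_div, ← hopfieldZ,
      div_self hZ.ne', ENNReal.ofReal_one]

lemma hopfieldGibbs_real (β : ℝ) {N M : ℕ} (ξ : Fin N → Fin M → Spin)
    (A : Set (Fin N → Spin)) :
    (hopfieldGibbs β ξ).real A
      = ∑ σ, hopfieldWeight β ξ σ / hopfieldZ β ξ * A.indicator (fun _ => 1) σ := by
  have hZ := hopfieldZ_pos β ξ
  rw [Measure.real, hopfieldGibbs, Measure.coe_finsetSum, Finset.sum_apply,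
    ENNReal.toReal_sum]
  · refine Finset.sum_congr rfl fun σ _ => ?_
    rw [Measure.smul_apply, smul_eq_mul, ENNReal.toReal_mul,
      ENNReal.toReal_ofReal (div_nonneg (hopfieldWeight_pos β ξ σ).le hZ.le),
      Measure.dirac_apply]
    congr 1
    by_cases h : σ ∈ A <;> simp [h]
  · intro σ _
    rw [Measure.smul_apply, smul_eq_mul]
    exact ENNReal.mul_ne_top ENNReal.ofReal_ne_top (measure_ne_top _ _)

instance isProbabilityMeasure_rademacher : IsProbabilityMeasure rademacher where
  measure_univ := by
    simp [rademacher, ENNReal.inv_two_add_inv_two]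

instance isProbabilityMeasure_rademacherPi (k : ℕ) : IsProbabilityMeasure (rademacherPi k) := by
  unfold rademacherPi; infer_instance

lemma rademacher_singleton (s : Spin) : rademacher {s} = 2⁻¹ := by
  rcases s.eq_one_or with rfl | rfl <;> simp [rademacher]

lemma rademacherPi_real (k : ℕ) (A : Set (Fin k → Spin)) :
    (rademacherPi k).real A = (2 ^ k)⁻¹ * ∑ τ, A.indicator (fun _ => 1) τ := by
  classical
  have h1 : ∀ τ : Fin k → Spin, (rademacherPi k).real {τ} = (2 ^ k)⁻¹ := fun τ => by
    simp [Measure.real, rademacherPi, Measure.pi_singleton, rademacher_singleton]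
  have h2 : A = ((Finset.univ.filter (· ∈ A) : Finset (Fin k → Spin)) : Set (Fin k → Spin)) := by
    ext; simp
  rw [h2, ← sum_measureReal_singleton]
  simp only [h1, Finset.sum_const, Set.indicator_apply, Finset.mem_coe, Finset.mem_filter,
    Finset.mem_univ, true_and]
  rw [Finset.sum_ite, Finset.sum_const_zero, add_zero, Finset.sum_const]
  simp [mul_comm]

/-- Testing with the event that a positive statistic `G` exceeds a threshold `t`. -/
lemma one_sub_tvDist_hopfieldMarginal_le (β : ℝ) {k m M : ℕ} (ξ : Fin (k + m) → Fin M → Spin)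
    (G : (Fin k → Spin) → ℝ) (hG : ∀ τ, 0 < G τ) {t : ℝ} (ht : 0 < t) :
    1 - tvDist (hopfieldMarginal β ξ (Nat.le_add_right k m)) (rademacherPi k)
      ≤ t / hopfieldZ β ξ
          * ∑ σ, hopfieldWeight β ξ σ * (G fun i => σ (Fin.castAdd m i))⁻¹
        + (2 ^ (k + m))⁻¹ / t * ∑ σ : Fin (k + m) → Spin, G fun i => σ (Fin.castAdd m i) := by
  have hZ := hopfieldZ_pos β ξ
  have hmeas : Measurable fun (σ : Fin (k + m) → Spin) (i : Fin k) =>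
      σ (Fin.castLE (Nat.le_add_right k m) i) :=
    measurable_pi_lambda _ fun i => measurable_pi_apply _
  have : IsProbabilityMeasure (hopfieldMarginal β ξ (Nat.le_add_right k m)) :=
    Measure.isProbabilityMeasure_map hmeas.aemeasurable
  have hA : MeasurableSet {τ : Fin k → Spin | t < G τ} := (Set.toFinite _).measurableSet
  refine (one_sub_tvDist_le _ _ hA).trans (add_le_add ?_ ?_)
  -- On `G ≤ t` the indicator is at most `t / G`; in the second error, on `G > t`, it is at most `G
  -- / t`.
  · rw [hopfieldMarginal, map_measureReal_apply hmeas hA.compl, hopfieldGibbs_real,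
      Finset.mul_sum]
    refine Finset.sum_le_sum fun σ _ => ?_
    have hw := hopfieldWeight_pos β ξ σ
    have hg := hG fun i => σ (Fin.castAdd m i)
    have : t / hopfieldZ β ξ * (hopfieldWeight β ξ σ * (G fun i => σ (Fin.castAdd m i))⁻¹)
        = hopfieldWeight β ξ σ / hopfieldZ β ξ * (t / G fun i => σ (Fin.castAdd m i)) := by
      field_simp
    rw [this]
    refine mul_le_mul_of_nonneg_left ?_ (div_pos hw hZ).le
    refine Set.indicator_apply_le' (fun h => ?_) fun _ => (div_pos ht hg).le
    rw [one_le_div hg]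
    exact not_lt.1 h
  · rw [rademacherPi_real, sum_append]
    simp only [Fin.append_left, Finset.sum_const, Finset.card_univ, Fintype.card_pi,
      Fintype.card_units_int, Finset.prod_const, Fintype.card_fin, nsmul_eq_mul]
    rw [← Finset.mul_sum, Nat.cast_pow, Nat.cast_ofNat]
    have : (2 ^ (k + m) : ℝ)⁻¹ / t * (2 ^ m * ∑ τ, G τ) = (2 ^ k)⁻¹ * ∑ τ, G τ / t := by
      rw [← Finset.sum_div, pow_add]
      field_simp
    rw [this]
    gcongr with τ
    refine Set.indicator_apply_le' (fun h => ?_) fun _ => (div_pos (hG τ) ht).le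
    rw [one_le_div ht]
    exact le_of_lt h

/-! ### The patterns are uniformly distributed -/

section Law

variable {Ω : Type*} [MeasurableSpace Ω] {P : Measure Ω} [IsProbabilityMeasure P]

lemma measure_preimage_spin_of_mean_zero {X : Ω → Spin} (hX : Measurable X)
    (h0 : ∫ ω, (X ω).toReal ∂P = 0) (s : Spin) : P (X ⁻¹' {s}) = 2⁻¹ := by
  have hm : ∀ s, MeasurableSet (X ⁻¹' {s}) := fun s => hX (measurableSet_singleton s)
  have hc : X ⁻¹' {-1} = (X ⁻¹' {1})ᶜ := by
    ext ω
    rcases (X ω).eq_one_or with h | h <;> simp [h, Units.ext_iff]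
  have e : (fun ω => (X ω).toReal)
      = fun ω => 2 * (X ⁻¹' {1}).indicator (fun _ => (1 : ℝ)) ω - 1 := by
    ext ω
    rcases (X ω).eq_one_or with h | h
    · simp [h]; norm_num
    · simp [h, Units.ext_iff]
  have h1 : P.real (X ⁻¹' {1}) = 1 / 2 := by
    rw [e, integral_sub (((integrable_const _).indicator (hm 1)).const_mul _)
      (integrable_const _), integral_const_mul, integral_indicator_const _ (hm 1)] at h0
    simp at h0
    linarith
  have h2 : P.real (X ⁻¹' {s}) = 1 / 2 := by
    rcases s.eq_one_or with rfl | rfl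
    · exact h1
    · rw [hc, probReal_compl_eq_one_sub (hm 1), h1]; norm_num
  rw [← ofReal_measureReal, h2, one_div, ENNReal.ofReal_inv_of_pos two_pos]
  simp

lemma IsPatternArray.measure_eq {N M : ℕ} {ξ : Fin N → Fin M → Ω → Spin}
    (hξ : IsPatternArray P ξ) (x : Fin N → Fin M → Spin) :
    P {ω | (fun i ν => ξ i ν ω) = x} = ENNReal.ofReal ((2 ^ N)⁻¹ ^ M) := by
  have h := hξ.indep.measure_inter_preimage_eq_mul Finset.univ
    (sets := fun p => {x p.1 p.2}) fun p _ => measurableSet_singleton _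
  have e : {ω | (fun i ν => ξ i ν ω) = x}
      = ⋂ p ∈ (Finset.univ : Finset (Fin N × Fin M)), ξ p.1 p.2 ⁻¹' {x p.1 p.2} := by
    ext ω
    simp [funext_iff]
  rw [e, h]
  simp only [measure_preimage_spin_of_mean_zero (hξ.measurable _ _) (hξ.mean_zero _ _),
    Finset.prod_const, Finset.card_univ, Fintype.card_prod, Fintype.card_fin]
  rw [ENNReal.ofReal_pow (by positivity), ENNReal.ofReal_inv_of_pos (by positivity),
    ENNReal.ofReal_pow (by positivity), ← ENNReal.inv_pow]
  simp [ENNReal.inv_pow, pow_mul]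

/-- Markov's inequality for the uniform law of the patterns. -/
lemma IsPatternArray.measure_ge_le {N M : ℕ} {ξ : Fin N → Fin M → Ω → Spin}
    (hξ : IsPatternArray P ξ) (h B : (Fin N → Fin M → Spin) → ℝ) (hB0 : ∀ x, 0 ≤ B x)
    (hB : ∀ x, h x ≤ B x) {ε : ℝ} (hε : 0 < ε) :
    P {ω | ε ≤ h fun i ν => ξ i ν ω}
      ≤ ENNReal.ofReal ((2 ^ N)⁻¹ ^ M * (∑ x, B x) / ε) := by
  classical
  -- A union bound over the finitely many pattern values needs no measurability of the event.
  have hsub : {ω | ε ≤ h fun i ν => ξ i ν ω}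
      ⊆ ⋃ x ∈ Finset.univ.filter fun x => ε ≤ h x, {ω | (fun i ν => ξ i ν ω) = x} := by
    intro ω hω
    simp only [Set.mem_iUnion]
    exact ⟨_, by simpa using hω, rfl⟩
  refine (measure_mono hsub).trans ((measure_biUnion_finset_le _ _).trans ?_)
  simp only [hξ.measure_eq]
  rw [← ENNReal.ofReal_sum_of_nonneg fun _ _ => by positivity]
  refine ENNReal.ofReal_le_ofReal ?_
  rw [mul_div_assoc, Finset.sum_div, Finset.mul_sum]
  refine (Finset.sum_le_sum fun x hx => ?_).trans (Finset.sum_le_sum_of_subset_of_nonneg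
    (Finset.subset_univ _) fun x _ _ => by have := hB0 x; positivity)
  refine le_mul_of_one_le_right (by positivity) ?_
  rw [one_le_div hε]
  exact (Finset.mem_filter.1 hx).2.trans (hB x)

end Law

/-! ### Annealed averages of the two errors -/

/-- The exponential of a multiple of the squared norm of the overlaps of the first `k` spins. -/
noncomputable def partialOverlapExp (c : ℝ) {k m M : ℕ} (ξ : Fin (k + m) → Fin M → Spin) (τ : Fin k → Spin) :
    ℝ :=
  ∏ ν, Real.exp (c * (∑ i, (τ i * ξ (Fin.castAdd m i) ν).toReal) ^ 2 / 2)

lemma partialOverlapExp_pos (c : ℝ) {k m M : ℕ} (ξ : Fin (k + m) → Fin M → Spin)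
    (τ : Fin k → Spin) : 0 < partialOverlapExp c ξ τ :=
  Finset.prod_pos fun _ _ => Real.exp_pos _

lemma sum_exp_sq_first_le (k m : ℕ) {c : ℝ} (hc0 : 0 ≤ c) (hc : c * k < 1) :
    ∑ ε : Fin (k + m) → Spin, Real.exp (c * (∑ i, (ε (Fin.castAdd m i)).toReal) ^ 2 / 2)
      ≤ 2 ^ (k + m) * (√(1 - c * k))⁻¹ := by
  have := sum_exp_sq_le k hc0 hc 0
  simp only [zero_add, ne_eq, OfNat.ofNat_ne_zero, not_false_eq_true, zero_pow, mul_zero,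
    zero_div, Real.exp_zero, mul_one] at this
  rw [sum_append]
  simp only [Fin.append_left, Finset.sum_const, Finset.card_univ, Fintype.card_pi,
    Fintype.card_units_int, Finset.prod_const, Fintype.card_fin, nsmul_eq_mul]
  rw [← Finset.mul_sum, Nat.cast_pow, Nat.cast_ofNat, pow_add]
  calc _ ≤ 2 ^ m * (2 ^ k * (√(1 - c * k))⁻¹) := by gcongr
    _ = _ := by ring

/-- Summing out the last `m` spins yields the coefficient `a / b` for the first `k`. Dividing by the
exponential with `a / (2 * b)` leaves that same exponential, so both errors involve the same moment:
hence the square root of the likelihood ratio. -/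
lemma sum_exp_sq_mul_inv_le (k m : ℕ) {a b : ℝ} (ha0 : 0 ≤ a) (hb : b = 1 - a * m)
    (hb0 : 0 < b) (hk : a / (2 * b) * k < 1) :
    ∑ ε : Fin (k + m) → Spin, Real.exp (a * (∑ i, (ε i).toReal) ^ 2 / 2)
        * (Real.exp (a / (2 * b) * (∑ i, (ε (Fin.castAdd m i)).toReal) ^ 2 / 2))⁻¹
      ≤ 2 ^ (k + m) * (√b)⁻¹ * (√(1 - a / (2 * b) * k))⁻¹ := by
  have h0 : 0 ≤ a / (2 * b) := by positivity
  have h2 := sum_exp_sq_le k h0 hk 0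
  simp only [zero_add, ne_eq, OfNat.ofNat_ne_zero, not_false_eq_true, zero_pow, mul_zero,
    zero_div, Real.exp_zero, mul_one] at h2
  rw [sum_append]
  simp only [Fin.append_left, Fin.append_right, Fin.sum_univ_add]
  have h1 : ∀ τ : Fin k → Spin, ∑ δ : Fin m → Spin,
      Real.exp (a * (∑ i, (τ i).toReal + ∑ i, (δ i).toReal) ^ 2 / 2)
        * (Real.exp (a / (2 * b) * (∑ i, (τ i).toReal) ^ 2 / 2))⁻¹
      ≤ 2 ^ m * (√b)⁻¹ * Real.exp (a / (2 * b) * (∑ i, (τ i).toReal) ^ 2 / 2) := fun τ => by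
    rw [← Finset.sum_mul, ← Real.exp_neg]
    refine (mul_le_mul_of_nonneg_right (sum_exp_sq_le m ha0 (by linarith) _)
      (Real.exp_pos _).le).trans_eq ?_
    rw [← hb, mul_assoc, ← Real.exp_add]
    congr 2
    field_simp
    ring
  refine (Finset.sum_le_sum fun τ _ => h1 τ).trans ?_
  rw [← Finset.mul_sum, pow_add]
  calc _ ≤ 2 ^ m * (√b)⁻¹ * (2 ^ k * (√(1 - a / (2 * b) * k))⁻¹) := by gcongr
    _ = _ := by ring

/-- The annealed averages over the patterns of the two errors of the test. -/
lemma sum_pattern_partialOverlapExp_le (k m M : ℕ) {c : ℝ} (hc0 : 0 ≤ c) (hc : c * k < 1)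
    (σ : Fin (k + m) → Spin) :
    ∑ x : Fin (k + m) → Fin M → Spin, partialOverlapExp c x (fun i => σ (Fin.castAdd m i))
      ≤ (2 ^ (k + m)) ^ M * (√(1 - c * k))⁻¹ ^ M := by
  rw [← mul_pow]
  refine le_trans (le_of_eq ?_) (pow_le_pow_left₀ (Finset.sum_nonneg fun _ _ =>
    (Real.exp_pos _).le) (sum_exp_sq_first_le k m hc0 hc) M)
  exact sum_pattern_prod
    (fun ε => Real.exp (c * (∑ i, (ε (Fin.castAdd m i)).toReal) ^ 2 / 2)) σ

lemma sum_pattern_hopfieldWeight_mul_inv_le (k m M : ℕ) {β b : ℝ} (hβ : 0 ≤ β)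
    (hN : 0 < k + m) (hb : b = 1 - β / (k + m : ℕ) * m) (hb0 : 0 < b)
    (hk : β / (k + m : ℕ) / (2 * b) * k < 1) (σ : Fin (k + m) → Spin) :
    ∑ x : Fin (k + m) → Fin M → Spin, hopfieldWeight β x σ *
        (partialOverlapExp (β / (k + m : ℕ) / (2 * b)) x fun i => σ (Fin.castAdd m i))⁻¹
      ≤ (2 ^ (k + m)) ^ M * ((√b)⁻¹ ^ M * (√(1 - β / (k + m : ℕ) / (2 * b) * k))⁻¹ ^ M) := by
  rw [← mul_pow, ← mul_pow]
  have ha : 0 ≤ β / (k + m : ℕ) := by positivity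
  refine le_trans (le_of_eq ?_) (pow_le_pow_left₀ (Finset.sum_nonneg fun _ _ => by positivity)
    ((sum_exp_sq_mul_inv_le k m ha hb hb0 hk).trans_eq (mul_assoc _ _ _)) M)
  rw [← sum_pattern_prod _ σ]
  refine Finset.sum_congr rfl fun x _ => ?_
  rw [hopfieldWeight_eq_prod β hN, partialOverlapExp, ← Finset.prod_inv_distrib,
    ← Finset.prod_mul_distrib]

/-! ### Combination of the bounds and the limit -/

/-- The bound on the probability that the distance is not close to one, at fixed size. -/
lemma measure_tvDist_hopfieldMarginal_le {Ω : Type*} [MeasurableSpace Ω] {P : Measure Ω}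
    [IsProbabilityMeasure P] {β : ℝ} (hβ : β ∈ Set.Ioo (0 : ℝ) 1) {N M k : ℕ} (hN : 0 < N)
    (hk : k ≤ N) {ξ : Fin N → Fin M → Ω → Spin} (hξ : IsPatternArray P ξ) {u : ℝ}
    (hu : u = β * (k / N : ℝ) / (1 - β + β * (k / N : ℝ))) {ε : ℝ} (hε : 0 < ε) :
    P {ω | ε ≤ |tvDist (hopfieldMarginal β (fun i ν => ξ i ν ω) hk) (rademacherPi k) - 1|}
      ≤ ENNReal.ofReal ((Real.exp (6 * (β / (1 - β)) ^ 2 * (M ^ 2 / N)) + 1)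
          * (√√(1 - u) / √(1 - u / 2)) ^ M / ε) := by
  obtain ⟨m, rfl⟩ := Nat.exists_eq_add_of_le hk
  obtain ⟨hβ0, hβ1⟩ := hβ
  have hN' : (0 : ℝ) < (k + m : ℕ) := by exact_mod_cast hN
  have h1β : 0 < 1 - β := by linarith
  set b : ℝ := 1 - β / (k + m : ℕ) * m with hb
  have hb' : b = 1 - β + β * (k / (k + m : ℕ) : ℝ) := by
    have hm : (m : ℝ) = (k + m : ℕ) - k := by push_cast; ring
    rw [hb, hm]; field_simp; ring
  have hkN : 0 ≤ β * (k / (k + m : ℕ) : ℝ) := by positivity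
  have hb0 : 0 < b := by rw [hb']; linarith
  -- Thus `1 - u = (1 - β) / b` compares the normalization of `Z_N` with the factor produced by the
  -- last `m` spins.
  have hub : b * (1 - u) = 1 - β := by
    have : b * u = β * (k / (k + m : ℕ) : ℝ) := by rw [hu, ← hb', mul_div_cancel₀ _ hb0.ne']
    linarith
  have hu1 : 0 < 1 - u := pos_of_mul_pos_right (hub ▸ h1β) hb0.le
  have hu0 : 0 ≤ u := by rw [hu, ← hb']; positivity
  set c : ℝ := β / (k + m : ℕ) / (2 * b) with hc
  have hc0 : 0 ≤ c := by positivity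
  have hck : c * k = u / 2 := by rw [hu, ← hb', hc]; field_simp
  have hck1 : c * k < 1 := by linarith
  set Q : ℝ := 6 * (β / (1 - β)) ^ 2 * (M ^ 2 / (k + m : ℕ)) with hQ
  have hx : 0 < √(1 - u) := Real.sqrt_pos.2 hu1
  set z : ℝ := √√(1 - u) with hz
  have hz0 : 0 < z := Real.sqrt_pos.2 hx
  have hz2 : z * z = √(1 - u) := Real.mul_self_sqrt hx.le
  set y : ℝ := √(1 - u / 2) with hy
  have hy0 : 0 < y := Real.sqrt_pos.2 (by linarith)
  have hsb : 0 < √b := Real.sqrt_pos.2 hb0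
  have hsβ : √(1 - β) = √b * (z * z) := by rw [hz2, ← Real.sqrt_mul hb0.le, hub]
  -- The value `(1 - u) ^ (-M / 4)` corresponds to likelihood ratio one and balances the two errors.
  set t : ℝ := z⁻¹ ^ M with ht
  have ht0 : 0 < t := by positivity
  set G := fun (x : Fin (k + m) → Fin M → Spin) => partialOverlapExp c x with hG
  have hG0 : ∀ x τ, 0 < G x τ := fun x τ => partialOverlapExp_pos c x τ
  set L : ℝ := 2 ^ (k + m) * ((√(1 - β))⁻¹ ^ M * Real.exp (-Q)) with hL
  have hL0 : 0 < L := by rw [hL, hsβ]; positivity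
  set B : (Fin (k + m) → Fin M → Spin) → ℝ := fun x =>
    t / L * ∑ σ, hopfieldWeight β x σ * (G x fun i => σ (Fin.castAdd m i))⁻¹
      + (2 ^ (k + m))⁻¹ / t * ∑ σ : Fin (k + m) → Spin, G x fun i => σ (Fin.castAdd m i) with hB
  have hsum0 : ∀ x, 0 ≤ ∑ σ, hopfieldWeight β x σ * (G x fun i => σ (Fin.castAdd m i))⁻¹ :=
    fun x => Finset.sum_nonneg fun σ _ =>
      mul_nonneg (hopfieldWeight_pos β x σ).le (inv_nonneg.2 (hG0 _ _).le)
  have hB0 : ∀ x, 0 ≤ B x := fun x => by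
    refine add_nonneg (mul_nonneg (by positivity) (hsum0 x)) (mul_nonneg (by positivity) ?_)
    exact Finset.sum_nonneg fun σ _ => (hG0 _ _).le
  have hBx : ∀ x, |tvDist (hopfieldMarginal β x hk) (rademacherPi k) - 1| ≤ B x := fun x => by
    have hmeas : Measurable fun (σ : Fin (k + m) → Spin) (i : Fin k) => σ (Fin.castLE hk i) :=
      measurable_pi_lambda _ fun i => measurable_pi_apply _
    have : IsProbabilityMeasure (hopfieldMarginal β x hk) :=
      Measure.isProbabilityMeasure_map hmeas.aemeasurable
    rw [abs_sub_comm, abs_of_nonneg (sub_nonneg.2 (tvDist_le_one _ _))]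
    refine (one_sub_tvDist_hopfieldMarginal_le β x (G x) (hG0 x) ht0).trans ?_
    refine add_le_add (mul_le_mul_of_nonneg_right ?_ (hsum0 x)) le_rfl
    gcongr
    exact le_hopfieldZ ⟨hβ0, hβ1⟩ hN x
  refine (hξ.measure_ge_le _ B hB0 hBx hε).trans (ENNReal.ofReal_le_ofReal ?_)
  refine div_le_div_of_nonneg_right ?_ hε.le
  have hA1 : ∑ x : Fin (k + m) → Fin M → Spin,
      ∑ σ, hopfieldWeight β x σ * (G x fun i => σ (Fin.castAdd m i))⁻¹
      ≤ 2 ^ (k + m) * ((2 ^ (k + m)) ^ M * ((√b)⁻¹ ^ M * y⁻¹ ^ M)) := by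
    rw [Finset.sum_comm]
    refine (Finset.sum_le_sum fun σ _ => sum_pattern_hopfieldWeight_mul_inv_le k m M hβ0.le hN
      hb hb0 hck1 σ).trans_eq ?_
    rw [← hc, hck, ← hy]
    simp
  have hA2 : ∑ x : Fin (k + m) → Fin M → Spin,
      ∑ σ : Fin (k + m) → Spin, G x (fun i => σ (Fin.castAdd m i))
      ≤ 2 ^ (k + m) * ((2 ^ (k + m)) ^ M * y⁻¹ ^ M) := by
    rw [Finset.sum_comm]
    refine (Finset.sum_le_sum fun σ _ => sum_pattern_partialOverlapExp_le k m M hc0 hck1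
      σ).trans_eq ?_
    rw [hck, ← hy]
    simp
  calc (2 ^ (k + m))⁻¹ ^ M * ∑ x, B x
      ≤ (2 ^ (k + m))⁻¹ ^ M *
        (t / L * (2 ^ (k + m) * ((2 ^ (k + m)) ^ M * ((√b)⁻¹ ^ M * y⁻¹ ^ M)))
          + (2 ^ (k + m))⁻¹ / t * (2 ^ (k + m) * ((2 ^ (k + m)) ^ M * y⁻¹ ^ M))) := by
        simp only [hB]
        rw [Finset.sum_add_distrib, ← Finset.mul_sum, ← Finset.mul_sum]
        gcongr
    -- Since `√(1 - β) = √b * z²`, the errors become `exp Q * (z / y) ^ M` and `(z / y) ^ M`.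
    _ = _ := by
        have hT : (0 : ℝ) < 2 ^ (k + m) := by positivity
        have hE := Real.exp_pos Q
        rw [hL, hsβ, ht, Real.exp_neg]
        simp only [mul_pow, inv_pow, div_pow, mul_inv]
        have p1 := pow_pos hT M
        have p2 := pow_pos hz0 M
        have p3 := pow_pos hy0 M
        have p4 := pow_pos hsb M
        field_simp

/-- This is the Hellinger affinity of two centred Gaussians with variance ratio `1 - u`. It is below
one because `(1 - u / 2)² - (1 - u) = u² / 4 > 0`. -/
lemma sqrt_sqrt_one_sub_div_lt_one {u : ℝ} (hu : u ∈ Set.Ioo (0 : ℝ) 1) :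
    √√(1 - u) / √(1 - u / 2) < 1 := by
  obtain ⟨h0, h1⟩ := hu
  rw [div_lt_one (Real.sqrt_pos.2 (by linarith))]
  refine Real.sqrt_lt_sqrt (Real.sqrt_nonneg _) ?_
  rw [Real.sqrt_lt' (by linarith)]
  nlinarith [mul_pos h0 h0]

theorem theorem2
    (β : ℝ) (hβ : β ∈ Set.Ioo (0 : ℝ) 1)
    (ρ : ℝ) (hρ : ρ ∈ Set.Ioo (0 : ℝ) 1)
    (M k : ℕ → ℕ)
    (hM : Tendsto M atTop atTop)
    (hMN : (fun N : ℕ => (M N : ℝ)) =o[atTop] fun N : ℕ => Real.sqrt (N : ℝ))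
    (hk : ∀ N, k N ≤ N)
    (hkN : Tendsto (fun N : ℕ => (k N : ℝ) / (N : ℝ)) atTop (𝓝 ρ))
    (Ω : ℕ → Type*) [∀ N, MeasurableSpace (Ω N)]
    (P : ∀ N, Measure (Ω N)) [∀ N, IsProbabilityMeasure (P N)]
    (ξ : ∀ N, Fin N → Fin (M N) → Ω N → Spin)
    (hξ : ∀ N, IsPatternArray (P N) (ξ N)) :
    ∀ ε : ℝ, 0 < ε →
      Tendsto
        (fun N : ℕ => P N {ω | ε ≤
          |tvDist (hopfieldMarginal β (fun i ν => ξ N i ν ω) (hk N)) (rademacherPi (k N)) - 1|})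
        atTop (𝓝 0) := by
  intro ε hε
  have h1β : 0 < 1 - β := by linarith [hβ.2]
  set f : ℝ → ℝ := fun x => β * x / (1 - β + β * x) with hf
  have hden : 0 < 1 - β + β * ρ := by have := mul_pos hβ.1 hρ.1; linarith
  have hfρ : f ρ ∈ Set.Ioo (0 : ℝ) 1 :=
    ⟨div_pos (mul_pos hβ.1 hρ.1) hden, (div_lt_one hden).2 (by linarith)⟩
  have hfc : Tendsto (fun N : ℕ => f (k N / N)) atTop (𝓝 (f ρ)) :=
    ((tendsto_const_nhds.mul hkN).div (tendsto_const_nhds.add (tendsto_const_nhds.mul hkN))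
      hden.ne')
  have hr : Tendsto (fun N : ℕ => √√(1 - f (k N / N)) / √(1 - f (k N / N) / 2)) atTop
      (𝓝 (√√(1 - f ρ) / √(1 - f ρ / 2))) :=
    (tendsto_const_nhds.sub hfc).sqrt.sqrt.div
      (tendsto_const_nhds.sub (hfc.div_const 2)).sqrt
      (Real.sqrt_pos.2 (by linarith [hfρ.2])).ne'
  -- The ratio depends on `N` through `k N / N`; a fixed `q < 1` above its limit gives a uniform
  -- geometric rate in `M N`.
  obtain ⟨q, hq1, hq2⟩ := exists_between (sqrt_sqrt_one_sub_div_lt_one hfρ)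
  have hq0 : 0 ≤ q := le_trans (by positivity) hq1.le
  set C : ℝ := Real.exp (6 * (β / (1 - β)) ^ 2) + 1 with hC
  have hlim : Tendsto (fun N => ENNReal.ofReal (C * q ^ M N / ε)) atTop (𝓝 0) := by
    have h := ((((tendsto_pow_atTop_nhds_zero_of_lt_one hq0 hq2).comp hM).const_mul C).div_const
      ε)
    simpa using ENNReal.tendsto_ofReal h
  refine tendsto_of_tendsto_of_tendsto_of_le_of_le' tendsto_const_nhds hlim
    (Eventually.of_forall fun N => zero_le) ?_
  filter_upwards [hr.eventually_lt_const hq1, hMN.bound one_pos, eventually_gt_atTop 0]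
    with N hN1 hN2 hN
  refine (measure_tvDist_hopfieldMarginal_le hβ hN (hk N) (hξ N) (u := f (k N / N)) rfl
    hε).trans (ENNReal.ofReal_le_ofReal ?_)
  have hN' : (0 : ℝ) < N := by exact_mod_cast hN
  -- The growth condition enters only here, as `M N ≤ √N` eventually, to bound the loss in `Z_N` by
  -- a constant.
  have hMN1 : (M N : ℝ) ^ 2 / N ≤ 1 := by
    rw [div_le_one hN', ← Real.le_sqrt (by positivity) hN'.le]
    simpa [abs_of_nonneg (Real.sqrt_nonneg _)] using hN2
  have hexp : Real.exp (6 * (β / (1 - β)) ^ 2 * (M N ^ 2 / N)) + 1 ≤ C := by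
    rw [hC]
    exact add_le_add_left
      (Real.exp_le_exp.2 (mul_le_of_le_one_right (by positivity) hMN1)) 1
  gcongr
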